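/- Let $\mathbb{R}^3_1$ be $\mathbb{R}^3$ with the Lorentzian metric $\langle\,,\rangle=dx_1^2+dx_2^2-dx_3^2$. Let $\mathcal{M}$ be a Riemann surface with non-empty boundary, that is, a closed subset of a connected Riemann surface $\mathcal{M}'$ together with a non-empty closed subset $\partial\mathcal{M}\subseteq\mathcal{M}$ that contains the topological frontier of $\mathcal{M}$ in $\mathcal{M}'$ (for instance, a locally finite family of pairwise disjoint closed curves, some of which may be single points); put $\mathrm{Int}(\mathcal{M})=\mathcal{M}\setminus\partial\mathcal{M}$. Let $X:\mathcal{M}\to\mathbb{R}^3_1$ be a conformal maximal immersion, that is, a continuous map which on $\mathrm{Int}(\mathcal{M})$ is smooth, conformal and spacelike (the induced metric is Riemannian) and has zero mean curvature; it may be singular at boundary points. Suppose that the Lorentzian norm $$n:\mathcal{M}\to\mathbb{R},\qquad n(p)=\langle X(p),X(p)\rangle,$$ is positive outside a compact subset of $\mathcal{M}$ and is proper. Then $\mathcal{M}$ is relative parabolic: every bounded continuous function $f:\mathcal{M}\to\mathbb{R}$ that is harmonic on $\mathrm{Int}(\mathcal{M})$ and vanishes on $\partial\mathcal{M}$ is identically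 zero. -/

import Mathlib

open scoped Manifold ContDiff

noncomputable section

namespace LorentzSurface

/-! ### The Lorentz-Minkowski space `ℝ³₁` -/

/-- The Lorentzian metric `dx₁² + dx₂² - dx₃²` on `ℝ³`. -/
def lorentz (x y : Fin 3 → ℝ) : ℝ :=
  x 0 * y 0 + x 1 * y 1 - x 2 * y 2

/-- The Lorentzian cross product, characterized by `⟨x × y, w⟩ = det (x, y, w)`. In particular
`x × y` is Lorentz-orthogonal to `x` and to `y`. -/
def lorentzCross (x y : Fin 3 → ℝ) : Fin 3 → ℝ :=
  ![x 1 * y 2 - x 2 * y 1, x 2 * y 0 - x 0 * y 2, -(x 0 * y 1 - x 1 * y 0)]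

/-! ### Local theory of a parametrized surface `Y(u, v)`, with `z = u + i v` -/

/-- The partial derivative `∂/∂u`. -/
def dU (Y : ℂ → Fin 3 → ℝ) (z : ℂ) : Fin 3 → ℝ := fderiv ℝ Y z 1

/-- The partial derivative `∂/∂v`. -/
def dV (Y : ℂ → Fin 3 → ℝ) (z : ℂ) : Fin 3 → ℝ := fderiv ℝ Y z Complex.I

/-- The tangent plane of `Y` at `z` is spacelike: the induced metric is positive definite there
(in particular `Y` is an immersion at `z`). -/
def SpacelikeAt (Y : ℂ → Fin 3 → ℝ) (z : ℂ) : Prop :=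
  ∀ w : ℂ, w ≠ 0 → 0 < lorentz (fderiv ℝ Y z w) (fderiv ℝ Y z w)

/-- `z = u + i v` is an isothermal parameter for `Y` at `z`. -/
def IsothermalAt (Y : ℂ → Fin 3 → ℝ) (z : ℂ) : Prop :=
  lorentz (dU Y z) (dU Y z) = lorentz (dV Y z) (dV Y z) ∧ lorentz (dU Y z) (dV Y z) = 0

/-- The determinant `E G - F²` of the first fundamental form. -/
def firstDet (Y : ℂ → Fin 3 → ℝ) (z : ℂ) : ℝ :=
  lorentz (dU Y z) (dU Y z) * lorentz (dV Y z) (dV Y z) - lorentz (dU Y z) (dV Y z) ^ 2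

/-- The timelike unit normal `N = (Y_u × Y_v) / √(E G - F²)` (Gauss map) of a spacelike `Y`. -/
def unitNormal (Y : ℂ → Fin 3 → ℝ) (z : ℂ) : Fin 3 → ℝ :=
  (Real.sqrt (firstDet Y z))⁻¹ • lorentzCross (dU Y z) (dV Y z)

/-- The mean curvature `(e G - 2 f F + g E) / (2 (E G - F²))` of a spacelike `Y`, where
`e = ⟨Y_uu, N⟩`, `f = ⟨Y_uv, N⟩`, `g = ⟨Y_vv, N⟩`. -/
def meanCurvature (Y : ℂ → Fin 3 → ℝ) (z : ℂ) : ℝ :=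
  (lorentz (dU (dU Y) z) (unitNormal Y z) * lorentz (dV Y z) (dV Y z)
      - 2 * lorentz (dV (dU Y) z) (unitNormal Y z) * lorentz (dU Y z) (dV Y z)
      + lorentz (dV (dV Y) z) (unitNormal Y z) * lorentz (dU Y z) (dU Y z))
    / (2 * firstDet Y z)

/-! ### Riemann surfaces with boundary inside an ambient Riemann surface `S` -/

variable {S : Type*} [TopologicalSpace S]

/-- `M` is a closed region of the surface `S`, with boundary `bd`: a closed subset of `M` that
contains the topological frontier of `M`. The interior of the surface is then the open set
`M \ bd`. This covers a frontier made of a locally finite family of disjoint closed curves, and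
isolated boundary points around which `M` is a full neighbourhood (branch points); no regularity
of the boundary is imposed. -/
structure IsSurfaceWithBoundary (M bd : Set S) : Prop where
  isClosed : IsClosed M
  isClosed_bd : IsClosed bd
  bd_subset : bd ⊆ M
  frontier_subset : frontier M ⊆ bd

variable [ChartedSpace ℂ S]

/-- `f` is harmonic on the open subset `U` of the Riemann surface `S`: it is harmonic when it is
read in any holomorphic coordinate of the atlas. -/
def HarmonicOn (f : S → ℝ) (U : Set S) : Prop :=
  ∀ φ ∈ atlas ℂ S,
    InnerProductSpace.HarmonicOnNhd (f ∘ φ.symm) (φ.target ∩ φ.symm ⁻¹' U)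

/-- A Riemann surface `M` with boundary `bd` is relative parabolic if the only bounded harmonic
function (continuous up to the boundary) that vanishes on the boundary is the zero function. -/
def RelativeParabolic (M bd : Set S) : Prop :=
  ∀ f : S → ℝ, ContinuousOn f M → HarmonicOn f (M \ bd) →
    (∃ C : ℝ, ∀ p ∈ M, |f p| ≤ C) → (∀ p ∈ bd, f p = 0) → ∀ p ∈ M, f p = 0

/-- `X` is a conformal maximal immersion of the Riemann surface `M` with boundary `bd` in `ℝ³₁`: it
is continuous on `M` and, on the interior `M \ bd`, it is smooth, spacelike, conformal and of zero
mean curvature. It may be singular at boundary points. -/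
structure IsConformalMaximalImmersion (M bd : Set S) (X : S → Fin 3 → ℝ) : Prop where
  continuousOn : ContinuousOn X M
  smooth : ∀ φ ∈ atlas ℂ S, ContDiffOn ℝ ∞ (X ∘ φ.symm) (φ.target ∩ φ.symm ⁻¹' (M \ bd))
  spacelike : ∀ φ ∈ atlas ℂ S, ∀ z ∈ φ.target ∩ φ.symm ⁻¹' (M \ bd), SpacelikeAt (X ∘ φ.symm) z
  conformal : ∀ φ ∈ atlas ℂ S, ∀ z ∈ φ.target ∩ φ.symm ⁻¹' (M \ bd), IsothermalAt (X ∘ φ.symm) z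
  maximal : ∀ φ ∈ atlas ℂ S, ∀ z ∈ φ.target ∩ φ.symm ⁻¹' (M \ bd),
    meanCurvature (X ∘ φ.symm) z = 0

/-- The Lorentzian norm `n(p) = ⟨X(p), X(p)⟩`. -/
def lorentzNorm (X : S → Fin 3 → ℝ) (p : S) : ℝ := lorentz (X p) (X p)

end LorentzSurface

end

/-!
On a conformal maximal surface the coordinates of `X` are harmonic. In an isothermal parameter with
conformal factor `E` this gives `Δ n = 4 E`, while `|∇ n|² = 4 E |Xᵀ|² ≥ 4 E n`, because the normal
component of `X` is timelike. Hence `Δ log (n - 1) ≤ -4 E / (n - 1)² < 0` where `n > 1`: the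
function `log (n - 1)` is a strictly superharmonic exhaustion of the surface. As in Khas'minskii's
test, subtracting `ε log (n - 1)` from a bounded harmonic function pushes its maximum into the
compact set `n ≤ 2` or onto the boundary, so after `ε → 0` the function attains its maximum over
the surface, and the strong maximum principle carries that maximum to the boundary.
-/

namespace LorentzSurface

open scoped Topology Laplacian
open Filter Set InnerProductSpace

section SecondDerivative

variable {E F : Type*} [NormedAddCommGroup E] [NormedSpace ℝ E]
  [NormedAddCommGroup F] [NormedSpace ℝ F] {f : E → F} {x : E}

lemma differentiableAt_fderiv_apply (hf : ContDiffAt ℝ 2 f x) (v : E) :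
    DifferentiableAt ℝ (fun y => fderiv ℝ f y v) x :=
  ((hf.fderiv_right (m := 1) (by norm_num)).differentiableAt one_ne_zero).clm_apply
    (differentiableAt_const v)

lemma fderiv_fderiv_apply (hf : ContDiffAt ℝ 2 f x) (v w : E) :
    fderiv ℝ (fun y => fderiv ℝ f y w) x v = fderiv ℝ (fderiv ℝ f) x v w := by
  have hd : DifferentiableAt ℝ (fderiv ℝ f) x :=
    (hf.fderiv_right (m := 1) (by norm_num)).differentiableAt one_ne_zero
  simp [fderiv_clm_apply hd (differentiableAt_const w)]

lemma fderiv_fderiv_apply_comm (hf : ContDiffAt ℝ 2 f x) (v w : E) :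
    fderiv ℝ (fun y => fderiv ℝ f y w) x v = fderiv ℝ (fun y => fderiv ℝ f y v) x w := by
  rw [fderiv_fderiv_apply hf, fderiv_fderiv_apply hf]
  exact hf.isSymmSndFDerivAt (by simp) v w

lemma fderiv_fderiv_comp {f : E → ℝ} {g : ℝ → ℝ} (hg : ContDiffAt ℝ 2 g (f x))
    (hf : ContDiffAt ℝ 2 f x) (v : E) :
    fderiv ℝ (fun y => fderiv ℝ (g ∘ f) y v) x v =
      deriv (deriv g) (f x) * fderiv ℝ f x v ^ 2 +
        deriv g (f x) * fderiv ℝ (fun y => fderiv ℝ f y v) x v := by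
  have hfirst : (fun y => fderiv ℝ (g ∘ f) y v) =ᶠ[𝓝 x]
      fun y => deriv g (f y) * fderiv ℝ f y v := by
    filter_upwards [hf.eventually (by simp),
      hf.continuousAt.eventually (hg.eventually (by simp))] with y hfy hgy
    simp [((hgy.differentiableAt two_ne_zero).hasDerivAt.comp_hasFDerivAt y
      (hfy.differentiableAt two_ne_zero).hasFDerivAt).fderiv]
  have hdg : DifferentiableAt ℝ (deriv g) (f x) :=
    differentiableAt_fderiv_apply hg 1
  have h := (hdg.hasDerivAt.comp_hasFDerivAt x
    (hf.differentiableAt two_ne_zero).hasFDerivAt).mul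
    (differentiableAt_fderiv_apply hf v).hasFDerivAt
  rw [hfirst.fderiv_eq]
  refine (congrArg (fun L : E →L[ℝ] ℝ => L v) h.fderiv).trans ?_
  simp only [Function.comp_apply, add_apply, smul_apply, smul_eq_mul]
  ring

lemma fderiv_fderiv_bilinear {G H : Type*} [NormedAddCommGroup G] [NormedSpace ℝ G]
    [NormedAddCommGroup H] [NormedSpace ℝ H] (B : F →L[ℝ] G →L[ℝ] H) {g : E → G}
    (hf : ContDiffAt ℝ 2 f x) (hg : ContDiffAt ℝ 2 g x) (v : E) :
    fderiv ℝ (fun y => fderiv ℝ (fun z => B (f z) (g z)) y v) x v =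
      B (fderiv ℝ (fun y => fderiv ℝ f y v) x v) (g x) +
        (2 : ℝ) • B (fderiv ℝ f x v) (fderiv ℝ g x v) +
        B (f x) (fderiv ℝ (fun y => fderiv ℝ g y v) x v) := by
  have hfirst : (fun y => fderiv ℝ (fun z => B (f z) (g z)) y v) =ᶠ[𝓝 x]
      fun y => B (f y) (fderiv ℝ g y v) + B (fderiv ℝ f y v) (g y) := by
    filter_upwards [hf.eventually (by simp), hg.eventually (by simp)] with y hfy hgy
    simp [B.fderiv_of_bilinear (hfy.differentiableAt two_ne_zero)
      (hgy.differentiableAt two_ne_zero)]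
  have hf₁ := (hf.differentiableAt two_ne_zero).hasFDerivAt
  have hg₁ := (hg.differentiableAt two_ne_zero).hasFDerivAt
  have h := (B.hasFDerivAt_of_bilinear hf₁ (differentiableAt_fderiv_apply hg v).hasFDerivAt).add
    (B.hasFDerivAt_of_bilinear (differentiableAt_fderiv_apply hf v).hasFDerivAt hg₁)
  rw [hfirst.fderiv_eq]
  refine (congrArg (fun L : E →L[ℝ] H => L v) h.fderiv).trans ?_
  simp only [ContinuousLinearMap.precompR_apply, ContinuousLinearMap.compL_apply, add_apply,
    ContinuousLinearMap.comp_apply, ContinuousLinearMap.precompL_apply, two_smul]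
  abel

lemma deriv_deriv_nonpos_of_isLocalMax {g : ℝ → ℝ} {t : ℝ} (hg : ContinuousAt g t)
    (hmax : IsLocalMax g t) : deriv (deriv g) t ≤ 0 := by
  by_contra! hpos
  have hmin : IsLocalMin g t := isLocalMin_of_deriv_deriv_pos hpos hmax.deriv_eq_zero hg
  have hconst : g =ᶠ[𝓝 t] fun _ => g t := by
    filter_upwards [hmax, hmin] with s hle hge using le_antisymm hle hge
  have hzero : deriv (deriv g) t = 0 := by
    rw [hconst.deriv.deriv_eq]; simp
  exact hpos.ne' hzero

lemma fderiv_fderiv_nonpos_of_isLocalMax {f : E → ℝ} (hf : ContDiffAt ℝ 2 f x)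
    (hmax : IsLocalMax f x) (v : E) : fderiv ℝ (fun y => fderiv ℝ f y v) x v ≤ 0 := by
  have hline (s : ℝ) : HasDerivAt (fun s : ℝ => x + s • v) v s := by
    simpa using ((hasDerivAt_id s).smul_const v).const_add x
  have htendsto : Tendsto (fun s : ℝ => x + s • v) (𝓝 0) (𝓝 x) := by
    simpa using (hline 0).continuousAt.tendsto
  have hderiv : deriv (fun s : ℝ => f (x + s • v)) =ᶠ[𝓝 0]
      fun s => fderiv ℝ f (x + s • v) v := by
    filter_upwards [htendsto.eventually (hf.eventually (by simp))] with s hs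
    exact ((hs.differentiableAt two_ne_zero).hasFDerivAt.comp_hasDerivAt s (hline s)).deriv
  have hderiv₂ : HasDerivAt (fun s : ℝ => fderiv ℝ f (x + s • v) v)
      (fderiv ℝ (fun y => fderiv ℝ f y v) x v) 0 :=
    (differentiableAt_fderiv_apply hf v).hasFDerivAt.comp_hasDerivAt_of_eq 0 (hline 0) (by simp)
  rw [← hderiv₂.deriv, ← hderiv.deriv_eq]
  refine deriv_deriv_nonpos_of_isLocalMax ?_ ?_
  · exact hf.continuousAt.comp_of_eq (hline 0).continuousAt (by simp)
  · simpa [IsLocalMax, IsMaxFilter] using htendsto.eventually hmax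

end SecondDerivative

section LaplacianCalculus

variable {E F ι : Type*} [NormedAddCommGroup E] [InnerProductSpace ℝ E] [FiniteDimensional ℝ E]
  [NormedAddCommGroup F] [NormedSpace ℝ F] [Fintype ι] (b : OrthonormalBasis ι ℝ E) {x : E}

lemma laplacian_eq_sum_fderiv_fderiv {f : E → F} (hf : ContDiffAt ℝ 2 f x) :
    Δ f x = ∑ i, fderiv ℝ (fun y => fderiv ℝ f y (b i)) x (b i) := by
  simp [laplacian_eq_iteratedFDeriv_orthonormalBasis f b, iteratedFDeriv_two_apply,
    fderiv_fderiv_apply hf]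

lemma laplacian_nonpos_of_isLocalMax {f : E → ℝ} (hf : ContDiffAt ℝ 2 f x)
    (hmax : IsLocalMax f x) : Δ f x ≤ 0 := by
  rw [laplacian_eq_sum_fderiv_fderiv (stdOrthonormalBasis ℝ E) hf]
  exact Finset.sum_nonpos fun i _ => fderiv_fderiv_nonpos_of_isLocalMax hf hmax _

lemma laplacian_comp {f : E → ℝ} {g : ℝ → ℝ} (hg : ContDiffAt ℝ 2 g (f x))
    (hf : ContDiffAt ℝ 2 f x) :
    Δ (g ∘ f) x =
      deriv (deriv g) (f x) * ∑ i, fderiv ℝ f x (b i) ^ 2 + deriv g (f x) * Δ f x := by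
  rw [laplacian_eq_sum_fderiv_fderiv b (hg.comp x hf), laplacian_eq_sum_fderiv_fderiv b hf,
    Finset.mul_sum, Finset.mul_sum, ← Finset.sum_add_distrib]
  exact Finset.sum_congr rfl fun i _ => fderiv_fderiv_comp hg hf (b i)

lemma laplacian_bilinear {G H : Type*} [NormedAddCommGroup G] [NormedSpace ℝ G]
    [NormedAddCommGroup H] [NormedSpace ℝ H] (B : F →L[ℝ] G →L[ℝ] H) {f : E → F} {g : E → G}
    (hf : ContDiffAt ℝ 2 f x) (hg : ContDiffAt ℝ 2 g x) :
    Δ (fun y => B (f y) (g y)) x =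
      B (Δ f x) (g x) + (2 : ℝ) • ∑ i, B (fderiv ℝ f x (b i)) (fderiv ℝ g x (b i)) +
        B (f x) (Δ g x) := by
  have hB : ContDiffAt ℝ 2 (fun y => B (f y) (g y)) x :=
    (B.contDiff.contDiffAt.comp x hf).clm_apply hg
  simp only [laplacian_eq_sum_fderiv_fderiv b hf, laplacian_eq_sum_fderiv_fderiv b hg,
    laplacian_eq_sum_fderiv_fderiv b hB, fderiv_fderiv_bilinear B hf hg, map_sum,
    sum_apply, Finset.sum_add_distrib, Finset.smul_sum]

end LaplacianCalculus

lemma eventually_eq_of_harmonicAt_of_isLocalMax {f : ℂ → ℝ} {z : ℂ} (hf : HarmonicAt f z)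
    (hmax : IsLocalMax f z) : ∀ᶠ y in 𝓝 z, f y = f z := by
  obtain ⟨r, hr, hball⟩ := Metric.eventually_nhds_iff_ball.1 hf.eventually
  obtain ⟨G, hG, hre⟩ := HarmonicOnNhd.exists_analyticOnNhd_ball_re_eq hball
  -- The maximum modulus principle is applied to `exp G`, whose modulus is `exp f`.
  have hnorm : ∀ y ∈ Metric.ball z r, ‖Complex.exp (G y)‖ = Real.exp (f y) := fun y hy => by
    rw [Complex.norm_exp]; exact congrArg Real.exp (hre hy)
  have hz : z ∈ Metric.ball z r := Metric.mem_ball_self hr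
  have hnear : ∀ᶠ y in 𝓝 z, y ∈ Metric.ball z r := Metric.ball_mem_nhds z hr
  have hmaxNorm : IsLocalMax (norm ∘ fun y => Complex.exp (G y)) z := by
    filter_upwards [hnear, hmax] with y hy hle
    simpa only [Function.comp_apply, hnorm y hy, hnorm z hz] using Real.exp_le_exp.2 hle
  have hconst := Complex.norm_eventually_eq_of_isLocalMax
    (hnear.mono fun y hy => (hG y hy).differentiableAt.cexp) hmaxNorm
  filter_upwards [hnear, hconst] with y hy h
  exact Real.exp_injective (by rwa [hnorm y hy, hnorm z hz] at h)

section Surface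

variable {S : Type*} [TopologicalSpace S] {M bd : Set S}

lemma IsSurfaceWithBoundary.isOpen_diff (hM : IsSurfaceWithBoundary M bd) : IsOpen (M \ bd) := by
  have hinterior : M \ bd = interior M \ bd := by
    refine Subset.antisymm (fun p hp => ⟨?_, hp.2⟩) (sdiff_subset_sdiff_left interior_subset)
    by_contra hint
    exact hp.2 (hM.frontier_subset ⟨subset_closure hp.1, hint⟩)
  exact hinterior ▸ isOpen_interior.sdiff hM.isClosed_bd

lemma isCompact_sublevel_of_isProperMap {K : Set S} {n : S → ℝ} (hM : IsClosed M)
    (hproper : IsProperMap fun p : M => n p) (hK : IsCompact K) (hpos : ∀ p ∈ M \ K, 0 < n p)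
    (R : ℝ) : IsCompact {p ∈ M | n p ≤ R} := by
  have hn : ContinuousOn n M := continuousOn_iff_continuous_domRestrict.2 hproper.continuous
  refine (hK.union ((hproper.isCompact_preimage (isCompact_Icc (a := 0) (b := R))).image
    continuous_subtype_val)).of_isClosed_subset
    (hn.preimage_isClosed_of_isClosed hM isClosed_Iic) ?_
  rintro p ⟨hpM, hpR⟩
  by_cases hpK : p ∈ K
  · exact Or.inl hpK
  · exact Or.inr ⟨⟨p, hpM⟩, ⟨(hpos p ⟨hpM, hpK⟩).le, hpR⟩, rfl⟩

variable [ChartedSpace ℂ S] {f u v : S → ℝ} {U : Set S} {q : S}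

lemma tendsto_chartAt_symm (q : S) :
    Tendsto (chartAt ℂ q).symm (𝓝 (chartAt ℂ q q)) (𝓝 q) := by
  simpa [ContinuousAt] using (chartAt ℂ q).symm.continuousAt (x := chartAt ℂ q q) (by simp)

lemma isLocalMax_comp_chartAt_symm (h : IsLocalMax f q) :
    IsLocalMax (f ∘ (chartAt ℂ q).symm) (chartAt ℂ q q) := by
  filter_upwards [(tendsto_chartAt_symm q).eventually h] with y hy
  simpa using hy

lemma chartAt_mem_target_inter_preimage (hq : q ∈ U) :
    chartAt ℂ q q ∈ (chartAt ℂ q).target ∩ (chartAt ℂ q).symm ⁻¹' U := by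
  simp [hq]

lemma HarmonicOn.neg (hf : HarmonicOn f U) : HarmonicOn (-f) U :=
  fun φ hφ => HarmonicOnNhd.neg (hf φ hφ)

lemma HarmonicOn.harmonicAt_chartAt (hf : HarmonicOn f U) (hq : q ∈ U) :
    HarmonicAt (f ∘ (chartAt ℂ q).symm) (chartAt ℂ q q) :=
  hf _ (chart_mem_atlas ℂ q) _ (chartAt_mem_target_inter_preimage hq)

lemma HarmonicOn.eventually_eq_of_isLocalMax (hf : HarmonicOn f U) (hq : q ∈ U)
    (hmax : IsLocalMax f q) : ∀ᶠ p in 𝓝 q, f p = f q := by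
  have hchart := eventually_eq_of_harmonicAt_of_isLocalMax (hf.harmonicAt_chartAt hq)
    (isLocalMax_comp_chartAt_symm hmax)
  filter_upwards [((chartAt ℂ q).continuousAt (mem_chart_source ℂ q)).eventually hchart,
    (chartAt ℂ q).open_source.mem_nhds (mem_chart_source ℂ q)] with p hp hsource
  simpa [(chartAt ℂ q).left_inv hsource] using hp

lemma HarmonicOn.exists_mem_bd_eq_of_isMaxOn [PreconnectedSpace S]
    (hM : IsSurfaceWithBoundary M bd) (hbd : bd.Nonempty) (hfc : ContinuousOn f M)
    (hf : HarmonicOn f (M \ bd)) (hq : q ∈ M) (hmax : IsMaxOn f M q) : ∃ p ∈ bd, f p = f q := by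
  by_contra! hne
  have hclosed : IsClosed {p ∈ M | f p = f q} :=
    hfc.preimage_isClosed_of_isClosed hM.isClosed (isClosed_singleton (x := f q))
  have hopen : IsOpen {p ∈ M | f p = f q} := by
    refine isOpen_iff_mem_nhds.2 fun p ⟨hpM, hpq⟩ => ?_
    have hp : p ∈ M \ bd := ⟨hpM, fun h => hne p h hpq⟩
    have hnear := hM.isOpen_diff.mem_nhds hp
    have hlocal : IsLocalMax f p := by
      filter_upwards [hnear] with x hx using (hmax hx.1).trans_eq hpq.symm
    filter_upwards [hnear, hf.eventually_eq_of_isLocalMax hp hlocal] with x hx h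
    exact ⟨hx.1, h.trans hpq⟩
  have huniv := IsClopen.eq_univ ⟨hclosed, hopen⟩ ⟨q, hq, rfl⟩
  obtain ⟨p, hp⟩ := hbd
  exact hne p hp (huniv.ge (mem_univ p)).2

/-- `u` is of class `C²` near `q` with negative Laplacian at `q`, read in the preferred chart at
`q`. On a Riemann surface the sign of the Laplacian does not depend on the holomorphic chart. -/
def StrictlySuperharmonicAt (u : S → ℝ) (q : S) : Prop :=
  ContDiffAt ℝ 2 (u ∘ (chartAt ℂ q).symm) (chartAt ℂ q q) ∧
    Δ (u ∘ (chartAt ℂ q).symm) (chartAt ℂ q q) < 0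

lemma StrictlySuperharmonicAt.congr_of_eventuallyEq (hu : StrictlySuperharmonicAt u q)
    (huv : v =ᶠ[𝓝 q] u) : StrictlySuperharmonicAt v q := by
  have hchart := huv.comp_tendsto (tendsto_chartAt_symm q)
  exact ⟨hu.1.congr_of_eventuallyEq hchart, (laplacian_congr_nhds hchart).eq_of_nhds.trans_lt hu.2⟩

lemma StrictlySuperharmonicAt.not_isLocalMax_sub (hu : StrictlySuperharmonicAt u q)
    (hf : HarmonicAt (f ∘ (chartAt ℂ q).symm) (chartAt ℂ q q)) {ε : ℝ} (hε : 0 < ε) :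
    ¬ IsLocalMax (f - ε • u) q := by
  intro hmax
  have hεu : ContDiffAt ℝ 2 (ε • (u ∘ (chartAt ℂ q).symm)) (chartAt ℂ q q) := hu.1.const_smul ε
  have hnonpos : Δ (f ∘ (chartAt ℂ q).symm - ε • (u ∘ (chartAt ℂ q).symm)) (chartAt ℂ q q) ≤ 0 :=
    laplacian_nonpos_of_isLocalMax (hf.1.sub hεu) (isLocalMax_comp_chartAt_symm hmax)
  rw [hf.1.laplacian_sub hεu, laplacian_smul ε hu.1, hf.2.eq_of_nhds,
    Pi.zero_apply, zero_sub, smul_eq_mul] at hnonpos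
  exact (mul_neg_of_pos_of_neg hε hu.2).not_ge (by linarith)

/-- A Khas'minskii function of the surface `M` with boundary `bd`: a non-negative exhaustion of `M`
that is strictly superharmonic at the interior points outside its (compact) zero set. Its existence
forces relative parabolicity. -/
structure IsKhasminskiiFunction (M bd : Set S) (u : S → ℝ) : Prop where
  continuousOn : ContinuousOn u M
  nonneg : ∀ p ∈ M, 0 ≤ u p
  isCompact_sublevel : ∀ R, IsCompact {p ∈ M | u p ≤ R}
  strictlySuperharmonicAt : ∀ p ∈ M \ bd, 0 < u p → StrictlySuperharmonicAt u p

namespace IsKhasminskiiFunction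

lemma sub_smul_le (hu : IsKhasminskiiFunction M bd u) (hM : IsSurfaceWithBoundary M bd)
    (hfc : ContinuousOn f M) (hf : HarmonicOn f (M \ bd)) {C : ℝ} (hC : ∀ p ∈ M, f p ≤ C)
    {a : ℝ} (hbd : ∀ p ∈ bd, f p ≤ a) (hzero : ∀ p ∈ M, u p = 0 → f p ≤ a) {ε : ℝ} (hε : 0 < ε) :
    ∀ p ∈ M, (f - ε • u) p ≤ a := by
  intro p hp
  -- At height `R` the penalty `ε * u` outweighs the bound `C`.
  set R := max (u p) ((C - a) / ε)
  obtain ⟨q, ⟨hqM, hqR⟩, hqmax⟩ := (hu.isCompact_sublevel R).exists_isMaxOn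
    ⟨p, hp, le_max_left _ _⟩
    ((hfc.sub (hu.continuousOn.const_smul ε)).mono fun x hx => hx.1)
  refine (hqmax ⟨hp, le_max_left _ _⟩ : _ ≤ (f - ε • u) q).trans ?_
  simp only [Pi.sub_apply, Pi.smul_apply, smul_eq_mul]
  have hpenalty : 0 ≤ ε * u q := mul_nonneg hε.le (hu.nonneg q hqM)
  by_cases hqbd : q ∈ bd
  · linarith [hbd q hqbd]
  rcases (hu.nonneg q hqM).eq_or_lt' with hq0 | hq0
  · linarith [hzero q hqM hq0]
  rcases hqR.eq_or_lt with hqR | hqR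
  · have : C - a ≤ ε * u q := (div_le_iff₀' hε).1 (hqR ▸ le_max_right _ _)
    linarith [hC q hqM]
  · refine absurd ?_ ((hu.strictlySuperharmonicAt q ⟨hqM, hqbd⟩ hq0).not_isLocalMax_sub
      (hf.harmonicAt_chartAt ⟨hqM, hqbd⟩) hε)
    have hnear := hM.isOpen_diff.mem_nhds ⟨hqM, hqbd⟩
    have hucont : ContinuousAt u q :=
      hu.continuousOn.continuousAt (mem_of_superset hnear sdiff_subset)
    filter_upwards [hnear, hucont.eventually (gt_mem_nhds hqR)] with x hx hxR
    exact hqmax ⟨hx.1, hxR.le⟩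

lemma le_of_le_on_bd_of_le_on_zeros (hu : IsKhasminskiiFunction M bd u)
    (hM : IsSurfaceWithBoundary M bd) (hfc : ContinuousOn f M) (hf : HarmonicOn f (M \ bd)) {C : ℝ}
    (hC : ∀ p ∈ M, f p ≤ C) {a : ℝ} (hbd : ∀ p ∈ bd, f p ≤ a)
    (hzero : ∀ p ∈ M, u p = 0 → f p ≤ a) : ∀ p ∈ M, f p ≤ a := by
  intro p hp
  have hlim : Tendsto (fun ε : ℝ => f p - ε * u p) (𝓝[>] 0) (𝓝 (f p)) := by
    have : Continuous fun ε : ℝ => f p - ε * u p := by fun_prop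
    simpa using (this.tendsto 0).mono_left nhdsWithin_le_nhds
  refine le_of_tendsto hlim ?_
  filter_upwards [self_mem_nhdsWithin] with ε hε
  exact hu.sub_smul_le hM hfc hf hC hbd hzero hε p hp

variable [PreconnectedSpace S]

lemma nonpos_of_nonpos_on_bd (hu : IsKhasminskiiFunction M bd u) (hM : IsSurfaceWithBoundary M bd)
    (hbd : bd.Nonempty) (hfc : ContinuousOn f M) (hf : HarmonicOn f (M \ bd)) {C : ℝ}
    (hC : ∀ p ∈ M, f p ≤ C) (hfbd : ∀ p ∈ bd, f p ≤ 0) : ∀ p ∈ M, f p ≤ 0 := by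
  refine hu.le_of_le_on_bd_of_le_on_zeros hM hfc hf hC hfbd fun p hp hp0 => ?_
  by_contra! hpos
  obtain ⟨q, ⟨hqM, -⟩, hqmax⟩ := (hu.isCompact_sublevel 0).exists_isMaxOn ⟨p, hp, hp0.le⟩
    (hfc.mono fun x hx => hx.1)
  have hq : 0 < f q := hpos.trans_le (hqmax ⟨hp, hp0.le⟩)
  have hmax : IsMaxOn f M q := hu.le_of_le_on_bd_of_le_on_zeros hM hfc hf hC
    (fun x hx => (hfbd x hx).trans hq.le) fun x hx hx0 => hqmax ⟨hx, hx0.le⟩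
  obtain ⟨b, hb, hbq⟩ := hf.exists_mem_bd_eq_of_isMaxOn hM hbd hfc hqM hmax
  exact (hbq ▸ hfbd b hb).not_gt hq

theorem relativeParabolic (hu : IsKhasminskiiFunction M bd u) (hM : IsSurfaceWithBoundary M bd)
    (hbd : bd.Nonempty) : RelativeParabolic M bd := by
  rintro f hfc hf ⟨C, hC⟩ hfbd p hp
  have hle : f p ≤ 0 := hu.nonpos_of_nonpos_on_bd hM hbd hfc hf
    (fun x hx => (abs_le.1 (hC x hx)).2) (fun x hx => (hfbd x hx).le) p hp
  have hge : -f p ≤ 0 := hu.nonpos_of_nonpos_on_bd hM hbd hfc.neg hf.neg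
    (fun x hx => neg_le.1 (abs_le.1 (hC x hx)).1) (fun x hx => by simp [hfbd x hx]) p hp
  linarith

end IsKhasminskiiFunction

end Surface

section LorentzAlgebra

variable {a b x : Fin 3 → ℝ}

lemma lorentz_comm (x y : Fin 3 → ℝ) : lorentz x y = lorentz y x := by
  simp only [lorentz]; ring

lemma lorentz_add_left (x y z : Fin 3 → ℝ) :
    lorentz (x + y) z = lorentz x z + lorentz y z := by
  simp only [lorentz, Pi.add_apply]; ring

lemma lorentz_smul_left (c : ℝ) (x y : Fin 3 → ℝ) : lorentz (c • x) y = c * lorentz x y := by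
  simp only [lorentz, Pi.smul_apply, smul_eq_mul]; ring

/-- The Lorentzian metric as a bundled bilinear map, which gives access to the calculus of
continuous bilinear maps. -/
noncomputable def lorentzForm : (Fin 3 → ℝ) →L[ℝ] (Fin 3 → ℝ) →L[ℝ] ℝ :=
  (LinearMap.mk₂ ℝ lorentz lorentz_add_left lorentz_smul_left
    (fun x y z => by simp only [lorentz_comm x, lorentz_add_left])
    (fun c x y => by simp only [lorentz_comm x, lorentz_smul_left, smul_eq_mul]))
    |>.toContinuousBilinearMap

lemma lorentzForm_apply (x y : Fin 3 → ℝ) : lorentzForm x y = lorentz x y := rfl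

/-- The expansion of `x` in the frame `a`, `b`, `a × b`, cleared of denominators. -/
lemma gram_smul_eq (x a b : Fin 3 → ℝ) :
    (lorentz a a * lorentz b b - lorentz a b ^ 2) • x =
      (lorentz x a * lorentz b b - lorentz x b * lorentz a b) • a +
        (lorentz x b * lorentz a a - lorentz x a * lorentz a b) • b -
        lorentz x (lorentzCross a b) • lorentzCross a b := by
  ext i
  fin_cases i <;> simp [lorentz, lorentzCross] <;> ring

lemma eq_zero_of_lorentz_eq_zero (hab : lorentz a a * lorentz b b - lorentz a b ^ 2 ≠ 0)
    (ha : lorentz x a = 0) (hb : lorentz x b = 0) (hcross : lorentz x (lorentzCross a b) = 0) :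
    x = 0 := by
  have h := gram_smul_eq x a b
  simp only [ha, hb, hcross, zero_mul, sub_zero, zero_smul, add_zero] at h
  exact (smul_eq_zero.1 h).resolve_left hab

lemma mul_lorentz_self_le_sq_add_sq (hnorm : lorentz a a = lorentz b b)
    (horth : lorentz a b = 0) (hpos : 0 < lorentz a a) (x : Fin 3 → ℝ) :
    lorentz a a * lorentz x x ≤ lorentz x a ^ 2 + lorentz x b ^ 2 := by
  have h := congrArg (lorentz · x) (gram_smul_eq x a b)
  simp only [sub_eq_add_neg, ← neg_smul, lorentz_add_left, lorentz_smul_left] at h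
  simp only [horth, ← hnorm, lorentz_comm _ x] at h
  refine le_of_mul_le_mul_left ?_ hpos
  linarith [sq_nonneg (lorentz x (lorentzCross a b))]

end LorentzAlgebra

section IsothermalParameter

variable {Y : ℂ → Fin 3 → ℝ} {z : ℂ}

lemma laplacian_eq_dU_dU_add_dV_dV (hY : ContDiffAt ℝ 2 Y z) :
    Δ Y z = dU (dU Y) z + dV (dV Y) z := by
  have h := laplacian_eq_sum_fderiv_fderiv Complex.orthonormalBasisOneI hY
  simp only [Fin.sum_univ_two, Complex.coe_orthonormalBasisOneI, Matrix.cons_val_zero,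
    Matrix.cons_val_one] at h
  exact h

lemma fderiv_lorentz {A B : ℂ → Fin 3 → ℝ} (hA : DifferentiableAt ℝ A z)
    (hB : DifferentiableAt ℝ B z) (w : ℂ) :
    fderiv ℝ (fun y => lorentz (A y) (B y)) z w =
      lorentz (fderiv ℝ A z w) (B z) + lorentz (fderiv ℝ B z w) (A z) := by
  have h : fderiv ℝ (fun y => lorentz (A y) (B y)) z = _ :=
    lorentzForm.fderiv_of_bilinear hA hB
  rw [h, lorentz_comm _ (A z), add_comm]
  rfl

lemma lorentz_laplacian_tangent_eq_zero (hY : ContDiffAt ℝ 2 Y z)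
    (hconf : ∀ᶠ y in 𝓝 z, IsothermalAt Y y) :
    lorentz (Δ Y z) (dU Y z) = 0 ∧ lorentz (Δ Y z) (dV Y z) = 0 := by
  have hU : DifferentiableAt ℝ (dU Y) z := differentiableAt_fderiv_apply hY 1
  have hV : DifferentiableAt ℝ (dV Y) z := differentiableAt_fderiv_apply hY Complex.I
  have hmixed : dV (dU Y) z = dU (dV Y) z := fderiv_fderiv_apply_comm hY Complex.I 1
  have hE (w : ℂ) : lorentz (fderiv ℝ (dU Y) z w) (dU Y z) =
      lorentz (fderiv ℝ (dV Y) z w) (dV Y z) := by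
    have h := congrArg (fun L : ℂ →L[ℝ] ℝ => L w)
      (EventuallyEq.fderiv_eq (hconf.mono fun _ h => h.1))
    simp only [fderiv_lorentz hU hU, fderiv_lorentz hV hV] at h
    linarith
  have hF (w : ℂ) : lorentz (fderiv ℝ (dU Y) z w) (dV Y z) +
      lorentz (fderiv ℝ (dV Y) z w) (dU Y z) = 0 := by
    have h := congrArg (fun L : ℂ →L[ℝ] ℝ => L w)
      (EventuallyEq.fderiv_eq (f := fun _ => 0) (hconf.mono fun _ h => h.2))
    simpa [fderiv_lorentz hU hV] using h
  have hEu : lorentz (dU (dU Y) z) (dU Y z) = lorentz (dU (dV Y) z) (dV Y z) := hE 1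
  have hEv : lorentz (dU (dV Y) z) (dU Y z) = lorentz (dV (dV Y) z) (dV Y z) :=
    hmixed ▸ hE Complex.I
  have hFu : lorentz (dU (dU Y) z) (dV Y z) + lorentz (dU (dV Y) z) (dU Y z) = 0 := hF 1
  have hFv : lorentz (dU (dV Y) z) (dV Y z) + lorentz (dV (dV Y) z) (dU Y z) = 0 :=
    hmixed ▸ hF Complex.I
  rw [laplacian_eq_dU_dU_add_dV_dV hY, lorentz_add_left, lorentz_add_left]
  constructor <;> linarith

lemma IsothermalAt.firstDet_eq (hconf : IsothermalAt Y z) :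
    firstDet Y z = lorentz (dU Y z) (dU Y z) ^ 2 := by
  rw [firstDet, ← hconf.1, hconf.2]; ring

lemma SpacelikeAt.lorentz_dU_pos (hs : SpacelikeAt Y z) : 0 < lorentz (dU Y z) (dU Y z) :=
  hs 1 one_ne_zero

lemma lorentz_laplacian_lorentzCross_eq_zero (hY : ContDiffAt ℝ 2 Y z) (hs : SpacelikeAt Y z)
    (hconf : IsothermalAt Y z) (hmean : meanCurvature Y z = 0) :
    lorentz (Δ Y z) (lorentzCross (dU Y z) (dV Y z)) = 0 := by
  have hpos := hs.lorentz_dU_pos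
  have hden : 2 * firstDet Y z ≠ 0 := by rw [hconf.firstDet_eq]; positivity
  have hsqrt : (√(firstDet Y z))⁻¹ ≠ 0 := by
    rw [hconf.firstDet_eq, Real.sqrt_sq hpos.le]; positivity
  have hnum := (div_eq_zero_iff.1 hmean).resolve_right hden
  simp only [unitNormal, lorentz_comm _ (_ • _), lorentz_smul_left, hconf.2, ← hconf.1] at hnum
  have hprod : ((√(firstDet Y z))⁻¹ * lorentz (dU Y z) (dU Y z)) *
      lorentz (Δ Y z) (lorentzCross (dU Y z) (dV Y z)) = 0 := by
    rw [laplacian_eq_dU_dU_add_dV_dV hY, lorentz_add_left, lorentz_comm (dU (dU Y) z),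
      lorentz_comm (dV (dV Y) z)]
    linear_combination hnum
  exact (mul_eq_zero.1 hprod).resolve_left (mul_ne_zero hsqrt hpos.ne')

theorem laplacian_eq_zero_of_meanCurvature_eq_zero (hY : ContDiffAt ℝ 2 Y z)
    (hs : SpacelikeAt Y z) (hconf : ∀ᶠ y in 𝓝 z, IsothermalAt Y y)
    (hmean : meanCurvature Y z = 0) : Δ Y z = 0 := by
  obtain ⟨hU, hV⟩ := lorentz_laplacian_tangent_eq_zero hY hconf
  have hdet : firstDet Y z ≠ 0 := by
    have := hs.lorentz_dU_pos
    rw [hconf.self_of_nhds.firstDet_eq]; positivity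
  exact eq_zero_of_lorentz_eq_zero hdet hU hV
    (lorentz_laplacian_lorentzCross_eq_zero hY hs hconf.self_of_nhds hmean)

lemma contDiffAt_lorentz_self (hY : ContDiffAt ℝ 2 Y z) :
    ContDiffAt ℝ 2 (fun y => lorentz (Y y) (Y y)) z :=
  (lorentzForm.contDiff.contDiffAt.comp z hY).clm_apply hY

lemma laplacian_lorentz_self (hY : ContDiffAt ℝ 2 Y z) (hΔ : Δ Y z = 0)
    (hconf : IsothermalAt Y z) :
    Δ (fun y => lorentz (Y y) (Y y)) z = 4 * lorentz (dU Y z) (dU Y z) := by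
  have h : Δ (fun y => lorentz (Y y) (Y y)) z = _ :=
    laplacian_bilinear Complex.orthonormalBasisOneI lorentzForm hY hY
  have hdU_dV := hconf.1
  simp only [hΔ, map_zero, zero_apply, Fin.sum_univ_two, Complex.coe_orthonormalBasisOneI,
    Matrix.cons_val_zero, Matrix.cons_val_one, lorentzForm_apply, smul_eq_mul] at h
  simp only [dU, dV] at hdU_dV ⊢
  linarith

lemma mul_lorentz_self_le_sq_fderiv (hY : DifferentiableAt ℝ Y z) (hs : SpacelikeAt Y z)
    (hconf : IsothermalAt Y z) :
    4 * lorentz (dU Y z) (dU Y z) * lorentz (Y z) (Y z) ≤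
      fderiv ℝ (fun y => lorentz (Y y) (Y y)) z 1 ^ 2 +
        fderiv ℝ (fun y => lorentz (Y y) (Y y)) z Complex.I ^ 2 := by
  have h := mul_lorentz_self_le_sq_add_sq hconf.1 hconf.2 hs.lorentz_dU_pos (Y z)
  simp only [lorentz_comm (Y z), dU, dV] at h
  simp only [fderiv_lorentz hY hY, dU]
  linarith

theorem laplacian_log_lorentz_self_sub_one_neg (hY : ContDiffAt ℝ 2 Y z) (hs : SpacelikeAt Y z)
    (hconf : IsothermalAt Y z) (hΔ : Δ Y z = 0) (hn : 1 < lorentz (Y z) (Y z)) :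
    Δ (fun y => Real.log (lorentz (Y y) (Y y) - 1)) z < 0 := by
  set n : ℂ → ℝ := fun y => lorentz (Y y) (Y y)
  set E := lorentz (dU Y z) (dU Y z)
  have hlog : ContDiffAt ℝ 2 (fun t => Real.log (t - 1)) (n z) :=
    (contDiffAt_id.sub contDiffAt_const).log (sub_pos.2 hn).ne'
  have hderiv : deriv (fun t => Real.log (t - 1)) = fun t => (t - 1)⁻¹ := by
    ext t; simp [deriv_comp_sub_const]
  have hderiv₂ : deriv (fun t : ℝ => (t - 1)⁻¹) (n z) = -((n z - 1) ^ 2)⁻¹ := by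
    simp [deriv_comp_sub_const (f := fun t : ℝ => t⁻¹)]
  have hgrad : 4 * E * n z ≤ fderiv ℝ n z 1 ^ 2 + fderiv ℝ n z Complex.I ^ 2 :=
    mul_lorentz_self_le_sq_fderiv (hY.differentiableAt two_ne_zero) hs hconf
  have hE : 0 < E := hs.lorentz_dU_pos
  have hn₁ : 0 < n z - 1 := sub_pos.2 hn
  calc Δ ((fun t => Real.log (t - 1)) ∘ n) z
      = -((n z - 1) ^ 2)⁻¹ * (fderiv ℝ n z 1 ^ 2 + fderiv ℝ n z Complex.I ^ 2) +
          (n z - 1)⁻¹ * (4 * E) := by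
        rw [laplacian_comp Complex.orthonormalBasisOneI hlog (contDiffAt_lorentz_self hY),
          laplacian_lorentz_self hY hΔ hconf, hderiv, hderiv₂]
        simp [E]
    _ ≤ -((n z - 1) ^ 2)⁻¹ * (4 * E * n z) + (n z - 1)⁻¹ * (4 * E) := by
        gcongr ?_ + _
        exact mul_le_mul_of_nonpos_left hgrad (neg_nonpos.2 (by positivity))
    _ = -(4 * E / (n z - 1) ^ 2) := by field_simp; ring
    _ < 0 := neg_neg_of_pos (by positivity)

end IsothermalParameter

section LogExhaustion

/-- The profile `log (t - 1)`, cut off below `t = 2` so as to be continuous and non-negative on the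
whole line. -/
noncomputable def cutoffLog (t : ℝ) : ℝ := Real.log (max t 2 - 1)

lemma one_le_max_two_sub_one (t : ℝ) : 1 ≤ max t 2 - 1 := by
  linarith [le_max_right t 2]

lemma continuous_cutoffLog : Continuous cutoffLog :=
  Continuous.log (by fun_prop) fun t => (one_pos.trans_le (one_le_max_two_sub_one t)).ne'

lemma cutoffLog_nonneg (t : ℝ) : 0 ≤ cutoffLog t := Real.log_nonneg (one_le_max_two_sub_one t)

lemma two_lt_of_cutoffLog_pos {t : ℝ} (ht : 0 < cutoffLog t) : 2 < t := by
  contrapose! ht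
  norm_num [cutoffLog, max_eq_right ht]

lemma le_exp_add_one_of_cutoffLog_le {t R : ℝ} (ht : cutoffLog t ≤ R) : t ≤ Real.exp R + 1 := by
  have h := (Real.log_le_iff_le_exp (one_pos.trans_le (one_le_max_two_sub_one t))).1 ht
  linarith [le_max_left t 2]

lemma cutoffLog_eventuallyEq {t : ℝ} (ht : 2 < t) :
    cutoffLog =ᶠ[𝓝 t] fun s => Real.log (s - 1) := by
  filter_upwards [lt_mem_nhds ht] with s hs
  rw [cutoffLog, max_eq_left hs.le]

variable {S : Type*} [TopologicalSpace S] [ChartedSpace ℂ S] {M bd : Set S} {X : S → Fin 3 → ℝ}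

lemma IsConformalMaximalImmersion.continuousOn_lorentzNorm
    (hX : IsConformalMaximalImmersion M bd X) : ContinuousOn (lorentzNorm X) M := by
  have : Continuous fun x : Fin 3 → ℝ => lorentz x x := by unfold lorentz; fun_prop
  exact this.comp_continuousOn hX.continuousOn

lemma IsConformalMaximalImmersion.strictlySuperharmonicAt_log
    (hX : IsConformalMaximalImmersion M bd X) (hM : IsSurfaceWithBoundary M bd) {q : S}
    (hq : q ∈ M \ bd) (hn : 1 < lorentzNorm X q) :
    StrictlySuperharmonicAt (fun p => Real.log (lorentzNorm X p - 1)) q := by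
  have hφ := chart_mem_atlas ℂ q
  have hz := chartAt_mem_target_inter_preimage hq
  have hnear := ((chartAt ℂ q).isOpen_inter_preimage_symm hM.isOpen_diff).mem_nhds hz
  have hY : ContDiffAt ℝ 2 (X ∘ (chartAt ℂ q).symm) (chartAt ℂ q q) :=
    ((hX.smooth _ hφ).contDiffAt hnear).of_le (WithTop.coe_le_coe.2 (le_top : (2 : ℕ∞) ≤ ⊤))
  have hs := hX.spacelike _ hφ _ hz
  have hconf := mem_of_superset hnear (hX.conformal _ hφ)
  have hΔ := laplacian_eq_zero_of_meanCurvature_eq_zero hY hs hconf (hX.maximal _ hφ _ hz)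
  have hn' : 1 < lorentz ((X ∘ (chartAt ℂ q).symm) (chartAt ℂ q q))
      ((X ∘ (chartAt ℂ q).symm) (chartAt ℂ q q)) := by
    simpa [lorentzNorm] using hn
  exact ⟨((contDiffAt_lorentz_self hY).sub contDiffAt_const).log (sub_pos.2 hn').ne',
    laplacian_log_lorentz_self_sub_one_neg hY hs (hX.conformal _ hφ _ hz) hΔ hn'⟩

theorem IsConformalMaximalImmersion.isKhasminskiiFunction
    (hX : IsConformalMaximalImmersion M bd X) (hM : IsSurfaceWithBoundary M bd)
    (hcompact : ∀ R, IsCompact {p ∈ M | lorentzNorm X p ≤ R}) :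
    IsKhasminskiiFunction M bd (cutoffLog ∘ lorentzNorm X) where
  continuousOn := continuous_cutoffLog.comp_continuousOn hX.continuousOn_lorentzNorm
  nonneg p _ := cutoffLog_nonneg _
  isCompact_sublevel R :=
    (hcompact (Real.exp R + 1)).of_isClosed_subset
      ((continuous_cutoffLog.comp_continuousOn
        hX.continuousOn_lorentzNorm).preimage_isClosed_of_isClosed hM.isClosed isClosed_Iic)
      fun _ hp => ⟨hp.1, le_exp_add_one_of_cutoffLog_le hp.2⟩
  strictlySuperharmonicAt q hq hpos := by
    have hq2 : 2 < lorentzNorm X q := two_lt_of_cutoffLog_pos hpos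
    have hcont : ContinuousAt (lorentzNorm X) q :=
      hX.continuousOn_lorentzNorm.continuousAt (mem_of_superset (hM.isOpen_diff.mem_nhds hq)
        sdiff_subset)
    exact (hX.strictlySuperharmonicAt_log hM hq (by linarith)).congr_of_eventuallyEq
      ((cutoffLog_eventuallyEq hq2).comp_tendsto hcont)

end LogExhaustion

end LorentzSurface

theorem mainTheorem1_general {S : Type*} [TopologicalSpace S] [PreconnectedSpace S]
    [ChartedSpace ℂ S] {M bd K : Set S} {X : S → Fin 3 → ℝ}
    (hM : LorentzSurface.IsSurfaceWithBoundary M bd) (hbd : bd.Nonempty)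
    (hX : LorentzSurface.IsConformalMaximalImmersion M bd X) (hK : IsCompact K)
    (hpos : ∀ p ∈ M \ K, 0 < LorentzSurface.lorentzNorm X p)
    (hproper : IsProperMap fun p : M => LorentzSurface.lorentzNorm X p) :
    LorentzSurface.RelativeParabolic M bd :=
  have hcompact := LorentzSurface.isCompact_sublevel_of_isProperMap hM.isClosed hproper hK hpos
  (hX.isKhasminskiiFunction hM hcompact).relativeParabolic hM hbd

theorem mainTheorem1 {S : Type*} [TopologicalSpace S] [T2Space S] [ConnectedSpace S]
    [ChartedSpace ℂ S] [IsManifold 𝓘(ℂ) 1 S]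
    (M bd : Set S) (hM : LorentzSurface.IsSurfaceWithBoundary M bd) (hbd : bd.Nonempty)
    (X : S → Fin 3 → ℝ) (hX : LorentzSurface.IsConformalMaximalImmersion M bd X)
    (hpos : ∃ K : Set S, IsCompact K ∧ K ⊆ M ∧ ∀ p ∈ M \ K, 0 < LorentzSurface.lorentzNorm X p)
    (hproper : IsProperMap (fun p : M => LorentzSurface.lorentzNorm X (p : S))) :
    LorentzSurface.RelativeParabolic M bd := by
  obtain ⟨K, hK, -, hKpos⟩ := hpos
  exact mainTheorem1_general hM hbd hX hK hKpos hproper
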